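/- Let $q$ be a prime power and let $C_2\subset C_1\subset\mathbf{F}_q^n$ be linear codes. For $I\subseteq\{1,\dots,n\}$ put $V_I=\{x\in\mathbf{F}_q^n \mid x_i=0 \text{ for all } i\notin I\}$, and define the $t$-th relative generalized Hamming weight by $$M_t(C_1,C_2)=\min_{I\subseteq\{1,\dots,n\}}\{\,|I| \;\mid\; \dim (C_1\cap V_I)-\dim (C_2\cap V_I)\ge t\,\},$$ with the convention $\min\emptyset=\infty$ (the set is empty exactly when $t>\dim C_1-\dim C_2$). **Theorem.** Fix real numbers $0\le R_1\le 1$, $0\le\delta\le 1$ and $0<\tau\le\min\{R_1,\delta\}$ with $R_1+\delta<1+\tau$. Then for any real $R_2$ with $0\le R_2\le R_1-\tau$, any prime power $q$ and all sufficiently large $n$, there exist linear codes $C_2\subsetneq C_1\subset\mathbf{F}_q^n$ such that $\dim C_1=\lfloor nR_1\rfloor$, $\dim C_2=\lceil nR_2\rceil$ and $M_{\lceil n\tau\rceil}(C_1,C_2)\ge\lfloor n\delta\rfloor$. -/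

import Mathlib

open Filter Module

/-- `V_I = {x ∈ F^n | i ∉ I → x_i = 0}`, the vectors supported in the index set `I`. -/
def coordSubspace (F : Type*) [Field F] {n : ℕ} (I : Finset (Fin n)) :
    Submodule F (Fin n → F) where
  carrier := {x | ∀ i, i ∉ I → x i = 0}
  zero_mem' := fun _ _ => rfl
  add_mem' := fun {x y} hx hy i hi => by simp [hx i hi, hy i hi]
  smul_mem' := fun c x hx i hi => by simp [hx i hi]

/-- The `t`-th relative generalized Hamming weight `M_t(C₁, C₂)`: the minimum of `|I|` over all
index sets `I` with `dim (C₁ ∩ V_I) - dim (C₂ ∩ V_I) ≥ t`. It takes values in `ℕ∞`; the minimum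
over the empty family (no such `I`, i.e. `t > dim C₁ - dim C₂` for nested codes) is `⊤`. -/
noncomputable def relGenHammingWeight {F : Type*} [Field F] {n : ℕ} (t : ℕ)
    (C₁ C₂ : Submodule F (Fin n → F)) : ℕ∞ :=
  ⨅ I ∈ {I : Finset (Fin n) |
      t + finrank F ↥(C₂ ⊓ coordSubspace F I) ≤ finrank F ↥(C₁ ⊓ coordSubspace F I)},
    (I.card : ℕ∞)

/-!
Any choice of `C₂ ⊆ C₁` satisfies `dim (C₁ ∩ V_I) - dim (C₂ ∩ V_I) ≤ dim (C₁ ∩ V_I)`, so it is enough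
to find `C₁` with `dim (C₁ ∩ V_I) < t` for all small `I`; then `C₂` may be an arbitrary subspace of
`C₁` of the prescribed dimension.

Such a `C₁` comes from a random parity check matrix. Write `k = ⌊n R₁⌋`, `s = ⌊n δ⌋`, `t = ⌈n τ⌉` and
`m = n - k`, and choose the columns `h₁, …, hₙ ∈ F^m`. The kernel of `x ↦ ∑ xᵢ hᵢ` has dimension at
least `k`, and cutting it down to dimension exactly `k` does no harm, so no rank condition on the
matrix is needed. If the kernel meets `V_I` in dimension at least `t` with `|I| ≤ s`, then `t` of the
columns indexed by `I` are linear combinations of at most `s - t` other columns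
(`exists_dependent_columns`). For fixed positions of these columns there are at most
`q ^ (m (n - t) + (s - t) t)` such matrices (`card_dependent_columns_le`), and there are at most `4 ^ n`
choices of positions. Since `R₁ + δ < 1 + τ`, the exponent `t (m - (s - t))` by which `q ^ (m n)`
exceeds the former number grows quadratically in `n`, so it outweighs `4 ^ n ≤ q ^ (2 n)` and some
matrix is good (`exists_columns`).
-/

/-! ### Coordinate subspaces and subspaces of prescribed dimension -/

theorem finrank_coordSubspace (F : Type*) [Field F] {n : ℕ} (I : Finset (Fin n)) :
    finrank F (coordSubspace F I) = I.card := by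
  classical
  let e : coordSubspace F I ≃ₗ[F] (I → F) :=
    { toFun := fun x i => x.1 i
      map_add' := fun _ _ => rfl
      map_smul' := fun _ _ => rfl
      invFun := fun y => ⟨fun i => if h : i ∈ I then y ⟨i, h⟩ else 0, fun i hi => by simp [hi]⟩
      left_inv := fun x => by
        ext i
        by_cases h : i ∈ I
        · simp [h]
        · simp [h, x.2 i h]
      right_inv := fun y => by
        ext i
        simp }
  rw [e.finrank_eq]
  simp

theorem coordSubspace_mono (F : Type*) [Field F] {n : ℕ} {I J : Finset (Fin n)} (h : J ⊆ I) :
    coordSubspace F J ≤ coordSubspace F I :=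
  fun _ hx i hi => hx i fun hJ => hi (h hJ)

theorem Submodule.exists_le_finrank_eq {K V : Type*} [DivisionRing K] [AddCommGroup V] [Module K V]
    (W : Submodule K V) {d : ℕ} (hd : d ≤ finrank K W) :
    ∃ U ≤ W, finrank K U = d := by
  obtain ⟨f, hf⟩ := exists_linearIndependent_of_le_finrank hd
  have hf' : LinearIndependent K (fun i => (f i : V)) := hf.map' W.subtype W.ker_subtype
  refine ⟨Submodule.span K (Set.range fun i => (f i : V)), ?_, ?_⟩
  · rw [Submodule.span_le]
    rintro _ ⟨i, rfl⟩
    exact (f i).2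
  · rw [finrank_span_eq_card hf', Fintype.card_fin]

/-! ### Dependent columns of a parity check matrix -/

/-- If the code with parity check columns `h` contains a `t`-dimensional space of words supported in
`I`, then some `t` columns in `I` lie in the span of at most `|I| - t` further columns. -/
theorem exists_dependent_columns {F : Type*} [Field F] {n m t : ℕ} (h : Fin n → Fin m → F)
    (I : Finset (Fin n))
    (hI : t ≤ finrank F
      ↥(LinearMap.ker (Fintype.linearCombination F h) ⊓ coordSubspace F I)) :
    ∃ J T : Finset (Fin n), Disjoint J T ∧ T.card = t ∧ J.card + t ≤ I.card ∧
      ∀ i ∈ T, h i ∈ Submodule.span F (h '' J) := by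
  classical
  -- `J` indexes a maximal independent subfamily of the columns in `I`.
  obtain ⟨b, hbI, -, hspan, hb⟩ :=
    exists_linearIndepOn_extension (K := F) (v := h) (linearIndepOn_empty F h)
      (Set.empty_subset (I : Set (Fin n)))
  obtain ⟨J, rfl⟩ := (I.finite_toSet.subset hbI).exists_finset_coe
  have hJI : J ⊆ I := by exact_mod_cast hbI
  have hdisj : Disjoint (coordSubspace F J)
      (LinearMap.ker (Fintype.linearCombination F h) ⊓ coordSubspace F I) := by
    rw [Submodule.disjoint_def]
    rintro x hxJ ⟨hx, -⟩
    have hx0 : ∑ i ∈ J, x i • h i = 0 := by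
      rw [Finset.sum_subset (Finset.subset_univ J) fun i _ hi => by rw [hxJ i hi, zero_smul]]
      simpa [Fintype.linearCombination_apply] using hx
    ext i
    by_cases hi : i ∈ J
    · exact linearIndepOn_finset_iff.1 hb x hx0 i hi
    · exact hxJ i hi
  have hcard : J.card + t ≤ I.card := by
    have h1 := Submodule.finrank_sup_add_finrank_inf_eq (coordSubspace F J)
      (LinearMap.ker (Fintype.linearCombination F h) ⊓ coordSubspace F I)
    rw [hdisj.eq_bot, finrank_bot, finrank_coordSubspace] at h1
    have h2 := Submodule.finrank_mono
      (sup_le (coordSubspace_mono F hJI)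
        (inf_le_right (a := LinearMap.ker (Fintype.linearCombination F h))))
    rw [finrank_coordSubspace] at h2
    omega
  obtain ⟨T, hT, hTt⟩ := Finset.exists_subset_card_eq (s := I \ J) (n := t) (by
    rw [Finset.card_sdiff_of_subset hJI]
    omega)
  refine ⟨J, T, Finset.disjoint_of_subset_right hT Finset.disjoint_sdiff, hTt, hcard,
    fun i hi => hspan ⟨i, ?_, rfl⟩⟩
  exact Finset.mem_coe.2 (Finset.mem_sdiff.1 (hT hi)).1

/-- A matrix whose columns in `T` are combinations of its columns in `J` is determined by its columns
outside `T` and the coefficients of these combinations. -/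
theorem card_dependent_columns_le {F : Type*} [Field F] [Fintype F] {n m : ℕ} (J T : Finset (Fin n))
    (hJT : Disjoint J T) :
    Nat.card {h : Fin n → Fin m → F // ∀ i ∈ T, h i ∈ Submodule.span F (h '' J)} ≤
      Fintype.card F ^ (m * (n - T.card) + J.card * T.card) := by
  classical
  let φ : ({i // i ∉ T} → Fin m → F) × (T → J → F) → Fin n → Fin m → F := fun p i =>
    if hi : i ∈ T then
      ∑ j : J, p.2 ⟨i, hi⟩ j • p.1 ⟨j, Finset.disjoint_left.1 hJT j.2⟩
    else p.1 ⟨i, hi⟩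
  have hsub : {h : Fin n → Fin m → F | ∀ i ∈ T, h i ∈ Submodule.span F (h '' J)} ⊆ Set.range φ := by
    intro h hh
    have hcoef : ∀ i : T, ∃ c : J → F, ∑ j : J, c j • h j = h i := fun i =>
      (Submodule.mem_span_image_finset_iff_exists_fun F).1 (hh i i.2)
    choose c hc using hcoef
    refine ⟨(fun i => h i, c), ?_⟩
    funext i
    by_cases hi : i ∈ T
    · simp only [φ, dif_pos hi]
      exact hc ⟨i, hi⟩
    · simp only [φ, dif_neg hi]
  have h1 := (Nat.card_mono (Set.toFinite _) hsub).trans (Finite.card_range_le φ)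
  refine h1.trans (le_of_eq ?_)
  have hT : Fintype.card {i // i ∉ T} = n - T.card := by
    rw [Fintype.card_subtype_compl, Fintype.card_fin, Fintype.card_coe]
  simp only [Nat.card_eq_fintype_card, Fintype.card_prod, Fintype.card_fun, Fintype.card_fin,
    Fintype.card_coe, hT]
  rw [pow_add, pow_mul, pow_mul]

/-! ### Existence of a good code -/

/-- The union bound over all positions `J`, `T` of dependent columns. The hypothesis says
`2 n < t (m - (s - t))`, written without subtraction. -/
theorem exists_columns {F : Type*} [Field F] [Fintype F] {n m s t : ℕ}
    (hbound : 2 * n + s * t < m * t + t * t) :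
    ∃ h : Fin n → Fin m → F, ∀ J T : Finset (Fin n), Disjoint J T → T.card = t → J.card + t ≤ s →
      ¬ ∀ i ∈ T, h i ∈ Submodule.span F (h '' J) := by
  classical
  by_contra! hbad
  let P : Finset (Finset (Fin n) × Finset (Fin n)) :=
    Finset.univ.filter fun p => Disjoint p.1 p.2 ∧ p.2.card = t ∧ p.1.card + t ≤ s
  let B : Finset (Fin n) × Finset (Fin n) → Finset (Fin n → Fin m → F) := fun p =>
    Finset.univ.filter fun h => ∀ i ∈ p.2, h i ∈ Submodule.span F (h '' p.1)
  have hcover : (Finset.univ : Finset (Fin n → Fin m → F)) ⊆ P.biUnion B := by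
    intro h _
    obtain ⟨J, T, hJT, hT, hJ, hh⟩ := hbad h
    exact Finset.mem_biUnion.2 ⟨(J, T), by simp [P, *], by simpa [B] using hh⟩
  have hq : 2 ≤ Fintype.card F := Fintype.one_lt_card
  -- Each position contributes less than a fraction `q ^ (-2 n)` of all matrices.
  have hB : ∀ p ∈ P, Fintype.card F ^ (2 * n) * (B p).card < Fintype.card F ^ (m * n) := by
    intro p hp
    obtain ⟨hdisj, hT, hJ⟩ := (Finset.mem_filter.1 hp).2
    have h1 := card_dependent_columns_le (F := F) (m := m) p.1 p.2 hdisj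
    rw [Nat.card_eq_fintype_card, Fintype.card_subtype, hT] at h1
    have htn : t ≤ n := by
      have := Finset.card_le_univ p.2
      rwa [hT, Fintype.card_fin] at this
    calc Fintype.card F ^ (2 * n) * (B p).card
        ≤ Fintype.card F ^ (2 * n) * Fintype.card F ^ (m * (n - t) + p.1.card * t) :=
          Nat.mul_le_mul_left _ h1
      _ = Fintype.card F ^ (2 * n + (m * (n - t) + p.1.card * t)) := (pow_add _ _ _).symm
      _ < Fintype.card F ^ (m * n) := by
          refine Nat.pow_lt_pow_right hq ?_
          obtain ⟨r, rfl⟩ := Nat.exists_eq_add_of_le htn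
          rw [Nat.add_sub_cancel_left]
          have h2 : (p.1.card + t) * t ≤ s * t := Nat.mul_le_mul_right _ hJ
          nlinarith
  have hP : P.card ≤ Fintype.card F ^ (2 * n) :=
    calc P.card ≤ (2 ^ n) * (2 ^ n) := by
          refine (Finset.card_le_univ P).trans (le_of_eq ?_)
          simp
      _ = 2 ^ (2 * n) := by rw [← pow_add, two_mul]
      _ ≤ Fintype.card F ^ (2 * n) := Nat.pow_le_pow_left hq _
  have htotal : Fintype.card F ^ (m * n) ≤ ∑ p ∈ P, (B p).card := by
    have h1 := (Finset.card_le_card hcover).trans Finset.card_biUnion_le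
    simpa [← pow_mul] using h1
  have hpos : 0 < Fintype.card F ^ (m * n) := by positivity
  have hne : P.Nonempty := by
    rw [Finset.nonempty_iff_ne_empty]
    intro h0
    rw [h0, Finset.sum_empty] at htotal
    omega
  have hlt : Fintype.card F ^ (2 * n) * ∑ p ∈ P, (B p).card <
      Fintype.card F ^ (2 * n) * Fintype.card F ^ (m * n) :=
    calc Fintype.card F ^ (2 * n) * ∑ p ∈ P, (B p).card
        = ∑ p ∈ P, Fintype.card F ^ (2 * n) * (B p).card := Finset.mul_sum _ _ _
      _ < ∑ _p ∈ P, Fintype.card F ^ (m * n) := Finset.sum_lt_sum_of_nonempty hne hB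
      _ = P.card * Fintype.card F ^ (m * n) := by rw [Finset.sum_const, smul_eq_mul]
      _ ≤ Fintype.card F ^ (2 * n) * Fintype.card F ^ (m * n) := Nat.mul_le_mul_right _ hP
  exact absurd htotal (not_le.2 (lt_of_mul_lt_mul_left hlt (Nat.zero_le _)))

theorem exists_code_finrank_inf_coordSubspace_lt (F : Type*) [Field F] [Finite F] {n k s t : ℕ}
    (hk : k ≤ n) (hbound : 2 * n + s * t + k * t < n * t + t * t) :
    ∃ C : Submodule F (Fin n → F), finrank F C = k ∧
      ∀ I : Finset (Fin n), I.card ≤ s → finrank F ↥(C ⊓ coordSubspace F I) < t := by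
  have := Fintype.ofFinite F
  obtain ⟨m, rfl⟩ := Nat.exists_eq_add_of_le hk
  obtain ⟨h, hh⟩ := exists_columns (F := F) (n := k + m) (m := m) (s := s) (t := t) (by nlinarith)
  have hker : k ≤ finrank F (LinearMap.ker (Fintype.linearCombination F h)) := by
    have h1 := LinearMap.finrank_range_add_finrank_ker (Fintype.linearCombination F h)
    have h2 := Submodule.finrank_le (LinearMap.range (Fintype.linearCombination F h))
    rw [finrank_fin_fun] at h1 h2
    omega
  obtain ⟨C, hC, hCk⟩ := Submodule.exists_le_finrank_eq _ hker
  refine ⟨C, hCk, fun I hI => ?_⟩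
  by_contra! hIt
  obtain ⟨J, T, hJT, hT, hJ, hspan⟩ := exists_dependent_columns (t := t) h I
    (hIt.trans (Submodule.finrank_mono (inf_le_inf_right _ hC)))
  exact hh J T hJT hT (hJ.trans hI) hspan

/-- The intersections with `C₂` only help, so `C₂` plays no role in this lower bound. -/
theorem le_relGenHammingWeight_of_finrank_lt {F : Type*} [Field F] {n s t : ℕ}
    {C₁ : Submodule F (Fin n → F)} (C₂ : Submodule F (Fin n → F))
    (h : ∀ I : Finset (Fin n), I.card ≤ s → finrank F ↥(C₁ ⊓ coordSubspace F I) < t) :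
    (s : ℕ∞) ≤ relGenHammingWeight t C₁ C₂ := by
  refine le_iInf₂ fun I hI => ?_
  by_contra! hlt
  have hI' : t + finrank F ↥(C₂ ⊓ coordSubspace F I) ≤
    finrank F ↥(C₁ ⊓ coordSubspace F I) := hI
  have := h I (by exact_mod_cast hlt.le)
  omega

theorem mainTheorem2 (R₁ δ τ : ℝ)
    (hR₁_nonneg : 0 ≤ R₁) (hR₁_le : R₁ ≤ 1) (hδ_nonneg : 0 ≤ δ) (hδ_le : δ ≤ 1)
    (hτ_pos : 0 < τ) (hτ_le : τ ≤ min R₁ δ) (hsum : R₁ + δ < 1 + τ)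
    (R₂ : ℝ) (hR₂_nonneg : 0 ≤ R₂) (hR₂_le : R₂ ≤ R₁ - τ)
    (F : Type*) [Field F] [Finite F] :
    ∀ᶠ n : ℕ in atTop, ∃ C₁ C₂ : Submodule F (Fin n → F),
      C₂ < C₁ ∧
      finrank F C₁ = ⌊(n : ℝ) * R₁⌋₊ ∧
      finrank F C₂ = ⌈(n : ℝ) * R₂⌉₊ ∧
      (⌊(n : ℝ) * δ⌋₊ : ℕ∞) ≤ relGenHammingWeight ⌈(n : ℝ) * τ⌉₊ C₁ C₂ := by
  have hε : 0 < 1 + τ - R₁ - δ := by linarith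
  -- `n τ ≥ 2` separates the two dimensions; `n τ (1 + τ - R₁ - δ) > 2` makes the counting bound hold.
  filter_upwards [tendsto_natCast_atTop_atTop.eventually_ge_atTop (2 / τ),
    tendsto_natCast_atTop_atTop.eventually_gt_atTop (2 / (τ * (1 + τ - R₁ - δ))),
    eventually_gt_atTop 0] with n hn1 hn2 hn0
  have hn : (0 : ℝ) < n := by exact_mod_cast hn0
  rw [div_le_iff₀ hτ_pos] at hn1
  rw [div_lt_iff₀ (by positivity)] at hn2
  set k := ⌊(n : ℝ) * R₁⌋₊ with hkdef
  set s := ⌊(n : ℝ) * δ⌋₊ with hsdef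
  set t := ⌈(n : ℝ) * τ⌉₊ with htdef
  have hk : (k : ℝ) ≤ n * R₁ := Nat.floor_le (by positivity)
  have hs : (s : ℝ) ≤ n * δ := Nat.floor_le (by positivity)
  have ht : n * τ ≤ (t : ℝ) := Nat.le_ceil _
  have hkn : k ≤ n := by
    have : (k : ℝ) ≤ n := hk.trans (mul_le_of_le_one_right hn.le hR₁_le)
    exact_mod_cast this
  have hbound : 2 * n + s * t + k * t < n * t + t * t := by
    have h1 : n * (1 + τ - R₁ - δ) ≤ (n : ℝ) + t - s - k := by linarith
    have h2 : (n * τ) * (n * (1 + τ - R₁ - δ)) ≤ (t : ℝ) * ((n : ℝ) + t - s - k) :=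
      mul_le_mul ht h1 (by positivity) (by positivity)
    have h3 : (2 : ℝ) * n < (n * τ) * (n * (1 + τ - R₁ - δ)) := by
      calc (2 : ℝ) * n < n * (τ * (1 + τ - R₁ - δ)) * n := mul_lt_mul_of_pos_right hn2 hn
        _ = (n * τ) * (n * (1 + τ - R₁ - δ)) := by ring
    have h4 : (2 : ℝ) * n + s * t + k * t < n * t + t * t := by linarith
    exact_mod_cast h4
  have hlt : ⌈(n : ℝ) * R₂⌉₊ < k := by
    have h1 : (⌈(n : ℝ) * R₂⌉₊ : ℝ) < n * R₂ + 1 := Nat.ceil_lt_add_one (by positivity)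
    have h2 : (n : ℝ) * R₁ < k + 1 := Nat.lt_floor_add_one _
    have h3 : (n : ℝ) * R₂ ≤ n * (R₁ - τ) := mul_le_mul_of_nonneg_left hR₂_le hn.le
    have h4 : (⌈(n : ℝ) * R₂⌉₊ : ℝ) < k := by linarith
    exact_mod_cast h4
  obtain ⟨C₁, hC₁, hC₁I⟩ := exists_code_finrank_inf_coordSubspace_lt F hkn hbound
  obtain ⟨C₂, hC₂₁, hC₂⟩ := Submodule.exists_le_finrank_eq C₁ (hlt.le.trans hC₁.ge)
  refine ⟨C₁, C₂, lt_of_le_of_ne hC₂₁ ?_, hC₁, hC₂, le_relGenHammingWeight_of_finrank_lt C₂ hC₁I⟩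
  rintro rfl
  omega
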